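/- Let $d\ge 0$, let $X$ be a locally compact metrisable space, and let $\mathbf n\mapsto\phi_{\mathbf n}$ be an action of the additive semigroup $\Sigma=\mathbb Z_+^d$ on $X$ by continuous proper surjections ($\phi_{\mathbf 0}=\mathrm{id}$, $\phi_{\mathbf m+\mathbf n}=\phi_{\mathbf m}\circ\phi_{\mathbf n}$). For $f\in C_0(X)$ put $\alpha_{\mathbf n}(f)=f\circ\phi_{\mathbf n}$. Let $\rho$ be a faithful $*$-representation of $C_0(X)$ on a Hilbert space $H$. On $H\otimes\ell^2(\Sigma)$ let $\pi(U_{\mathbf n}f)(\xi\otimes e_{\mathbf k})=\rho(\alpha_{\mathbf k}(f))\xi\otimes e_{\mathbf k+\mathbf n}$, and for $(f_{\mathbf n})\in\ell^1(\Sigma,C_0(X))$ let $\pi(\sum U_{\mathbf n}f_{\mathbf n})=\sum\pi(U_{\mathbf n}f_{\mathbf n})$. The analytic crossed product $\mathcal A=C_0(X)\times_\phi\mathbb Z_+^d$ is the operator norm closure of $\pi(\ell^1(\Sigma,C_0(X)))$; write $U_{\mathbf n}f$ for $\pi(U_{\mathbf n}f)$ and $f$ for $U_{\mathbf 0}f$.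 Let $\mathrm{Rad}\,\mathcal A$ (the Jacobson radical) be the intersection of all primitive ideals of $\mathcal A$, i.e. kernels of algebraically irreducible representations, and let $\mathrm{PRad}\,\mathcal A$ (the prime radical) be the intersection of all prime ideals of $\mathcal A$. For $J\subseteq\{1,\dots,d\}$ let $\Sigma_J=\{\mathbf n\in\Sigma: n_j>0\text{ for all }j\in J\}$. If $Y\subseteq X$ is closed and invariant, a relatively open $V\subseteq Y$ is called $J$-wandering for $(Y,\Phi|_Y)$ if $(\phi_{\mathbf n}|_Y)^{-1}(V)\cap V=\emptyset$ for all $\mathbf n\in\Sigma_J$. Define closed invariant sets $X_{J,\gamma}$ by transfinite recursion: $X_{J,0}=X$; $X_{J,\gamma+1}$ is $X_{J,\gamma}$ minus the union of all $J$-wandering open subsets of $(X_{J,\gamma},\Phi|_{X_{J,\gamma}})$; and $X_{J,\beta}=\bigcap_{\gamma<\beta}X_{J,\gamma}$ for a limit ordinal $\beta$. Let $\mathcal R_{J,\gamma}$ be the closed two-sided ideal of $\mathcal A$ generated by all monomials $U_{\mathbf n}f$ with $\mathbf n\in\Sigma_J$ and $f\in C_0(X)$ vanishing on $X_{J,\gamma}$,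 and let $\mathcal S_{J,\gamma}$ be the set of all elements $Bf$ with $B\in\mathcal R_{J,\gamma}$ and $f\in C_0(X)$ of compact support disjoint from $X_{J,\gamma}$. **Proposition.** For every ordinal $\gamma$ and every $J\subseteq\{1,\dots,d\}$, the set $\mathcal S_{J,\gamma}$ is contained in $\mathrm{Rad}\,\mathcal A$, and the ideal $\mathcal R_{J,\gamma}$ is contained in $\mathrm{Rad}\,\mathcal A$. If $\mathrm{PRad}\,\mathcal A$ is closed, then $\mathcal R_{J,\gamma}$ is contained in $\mathrm{PRad}\,\mathcal A$. -/

import Mathlib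

open Set Filter Topology
open scoped ENNReal ZeroAtInfty

universe u v w

noncomputable section

namespace AnalyticCrossedProduct



/-! ### Radicals of a (not necessarily unital) complex algebra -/

section Radicals

variable {A : Type u} [NonUnitalRing A] [Module ℂ A]

/-- A linear subspace which is a two-sided ideal. -/
def IsTwoSidedIdeal (I : Submodule ℂ A) : Prop :=
  ∀ a : A, ∀ x ∈ I, a * x ∈ I ∧ x * a ∈ I

/-- A proper two-sided ideal `P` is prime if `I * K ⊆ P` for two-sided ideals `I`, `K` forces
`I ⊆ P` or `K ⊆ P`. -/
def IsPrimeIdeal (P : Submodule ℂ A) : Prop :=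
  IsTwoSidedIdeal P ∧ P ≠ ⊤ ∧
    ∀ I K : Submodule ℂ A, IsTwoSidedIdeal I → IsTwoSidedIdeal K →
      (∀ x ∈ I, ∀ y ∈ K, x * y ∈ P) → I ≤ P ∨ K ≤ P

/-- An algebra homomorphism `τ : A → End V` is an (algebraically) irreducible representation if
it is nonzero and the only invariant linear subspaces are `0` and `V`. -/
def IsIrreducibleRep {V : Type u} [AddCommGroup V] [Module ℂ V]
    (τ : A →ₙₐ[ℂ] Module.End ℂ V) : Prop :=
  (∃ a : A, τ a ≠ 0) ∧
    ∀ W : Submodule ℂ V, (∀ a : A, ∀ x ∈ W, τ a x ∈ W) → W = ⊥ ∨ W = ⊤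

/-- A primitive ideal is the kernel of an irreducible representation. An irreducible `V` is
generated by any nonzero vector, hence is a quotient of `A`, so that it is no restriction to take
`V` in the universe of `A`. -/
def IsPrimitiveIdeal (P : Submodule ℂ A) : Prop :=
  ∃ (V : Type u) (_ : AddCommGroup V) (_ : Module ℂ V) (τ : A →ₙₐ[ℂ] Module.End ℂ V),
    IsIrreducibleRep τ ∧ ∀ a : A, a ∈ P ↔ τ a = 0

variable (A) in
/-- The Jacobson radical: the intersection of all primitive ideals. -/
def jacobsonRadical : Submodule ℂ A :=
  sInf {P | IsPrimitiveIdeal P}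

variable (A) in
/-- The prime radical: the intersection of all prime ideals. -/
def primeRadical : Submodule ℂ A :=
  sInf {P | IsPrimeIdeal P}

/-- The closed two-sided ideal generated by a set. -/
def closedIdealSpan [TopologicalSpace A] (s : Set A) : Submodule ℂ A :=
  sInf {I | IsTwoSidedIdeal I ∧ IsClosed (I : Set A) ∧ s ⊆ I}

end Radicals

/-! ### Dynamical systems over `ℤ₊ᵈ` -/

/-- An action `n ↦ φₙ` of the additive semigroup `ℤ₊ᵈ` on `X` by continuous proper
surjections. -/
structure DynSys (d : ℕ) (X : Type u) [TopologicalSpace X] where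
  map : (Fin d → ℕ) → X → X
  map_zero : map 0 = id
  map_add : ∀ m n, map (m + n) = map m ∘ map n
  proper : ∀ n, IsProperMap (map n)
  surjective : ∀ n, Function.Surjective (map n)

/-- `Σ_J`: the multi-indices all of whose entries in the directions of `J` are positive. -/
def sigma {d : ℕ} (J : Set (Fin d)) : Set (Fin d → ℕ) :=
  {n | ∀ j ∈ J, 0 < n j}

namespace DynSys

variable {d : ℕ} {X : Type u} [TopologicalSpace X] (Φ : DynSys d X)

/-- `V` is a `J`-wandering (relatively) open subset of the subsystem `(Y, Φ|_Y)`, where `Y` is an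
invariant subset of `X`: `V` is a relatively open subset of `Y`, and `(φₙ|_Y)⁻¹(V) ∩ V = ∅` for
all `n ∈ Σ_J`. -/
def IsWandering (J : Set (Fin d)) (Y V : Set X) : Prop :=
  (∃ O : Set X, IsOpen O ∧ V = O ∩ Y) ∧ ∀ n ∈ sigma J, Φ.map n ⁻¹' V ∩ V = ∅

/-- The complement in `Y` of the union of all `J`-wandering open subsets of `(Y, Φ|_Y)`. -/
def peel (J : Set (Fin d)) (Y : Set X) : Set X :=
  Y \ ⋃₀ {V | Φ.IsWandering J Y V}

/-- The transfinite sequence `X_{J,γ}`, which decreases to the strong `J`-centre: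
`X_{J,0} = X`, `X_{J,γ+1}` is obtained from `X_{J,γ}` by removing its `J`-wandering open subsets,
and intersections are taken at limit ordinals. -/
def stage (J : Set (Fin d)) (γ : Ordinal.{w}) : Set X :=
  Ordinal.limitRecOn (motive := fun _ => Set X) γ univ (fun _ Y => Φ.peel J Y)
    (fun β _ Y => ⋂ (δ : Ordinal.{w}) (h : δ < β), Y δ h)

theorem stage_zero (J : Set (Fin d)) : Φ.stage J (0 : Ordinal.{w}) = univ :=
  Ordinal.limitRecOn_zero _ _ _

theorem stage_add_one (J : Set (Fin d)) (γ : Ordinal.{w}) :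
    Φ.stage J (γ + 1) = Φ.peel J (Φ.stage J γ) :=
  Ordinal.limitRecOn_add_one _ _ _ _

theorem stage_limit (J : Set (Fin d)) (β : Ordinal.{w}) (hβ : Order.IsSuccLimit β) :
    Φ.stage J β = ⋂ (δ : Ordinal.{w}) (_ : δ < β), Φ.stage J δ :=
  Ordinal.limitRecOn_limit _ _ _ _ hβ

/-- The *-endomorphism `αₙ(f) = f ∘ φₙ` of `C₀(X)`. -/
def pull (n : Fin d → ℕ) (f : C₀(X, ℂ)) : C₀(X, ℂ) :=
  f.comp ⟨⟨Φ.map n, (Φ.proper n).continuous⟩, by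
    rw [(hasBasis_cocompact).tendsto_iff hasBasis_cocompact]
    exact fun K hK => ⟨_, (Φ.proper n).isCompact_preimage hK, fun _ hx => hx⟩⟩

@[simp] theorem pull_apply (n : Fin d → ℕ) (f : C₀(X, ℂ)) (x : X) :
    Φ.pull n f x = f (Φ.map n x) := rfl

theorem norm_pull_le (n : Fin d → ℕ) (f : C₀(X, ℂ)) : ‖Φ.pull n f‖ ≤ ‖f‖ := by
  rw [← ZeroAtInftyContinuousMap.norm_toBCF_eq_norm,
    BoundedContinuousFunction.norm_le (norm_nonneg f)]
  intro x
  rw [← ZeroAtInftyContinuousMap.norm_toBCF_eq_norm]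
  exact f.toBCF.norm_coe_le_norm (Φ.map n x)

theorem pull_zero (f : C₀(X, ℂ)) : Φ.pull 0 f = f := by
  ext x
  simp [Φ.map_zero]

theorem pull_pull (m n : Fin d → ℕ) (f : C₀(X, ℂ)) :
    Φ.pull m (Φ.pull n f) = Φ.pull (n + m) f := by
  ext x
  simp [Φ.map_add]

theorem pull_add (n : Fin d → ℕ) (f g : C₀(X, ℂ)) :
    Φ.pull n (f + g) = Φ.pull n f + Φ.pull n g := rfl

theorem pull_smul (n : Fin d → ℕ) (c : ℂ) (f : C₀(X, ℂ)) :
    Φ.pull n (c • f) = c • Φ.pull n f := rfl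

theorem pull_mul (n : Fin d → ℕ) (f g : C₀(X, ℂ)) :
    Φ.pull n (f * g) = Φ.pull n f * Φ.pull n g := rfl

end DynSys

/-! ### The analytic crossed product -/

/-- The Hilbert space `H ⊗ ℓ²(ℤ₊ᵈ)`, realised as `ℓ²(ℤ₊ᵈ; H)`. -/
abbrev Fock (d : ℕ) (H : Type v) [NormedAddCommGroup H] :=
  lp (fun _ : Fin d → ℕ => H) 2

section CrossedProduct

variable {d : ℕ} {X : Type u} [TopologicalSpace X] (Φ : DynSys d X)
  {H : Type v} [NormedAddCommGroup H] [InnerProductSpace ℂ H] [CompleteSpace H]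
  (ρ : C₀(X, ℂ) →⋆ₙₐ[ℂ] (H →L[ℂ] H))

open scoped Classical in
/-- The family `k ↦ ρ(α_{k-n}(f)) ξ_{k-n}` if `n ≤ k`, and `0` otherwise. -/
def monoFun (n : Fin d → ℕ) (f : C₀(X, ℂ)) (ξ : (Fin d → ℕ) → H) : (Fin d → ℕ) → H :=
  fun k => if n ≤ k then ρ (Φ.pull (k - n) f) (ξ (k - n)) else 0

theorem monoFun_add_right (n k : Fin d → ℕ) (f : C₀(X, ℂ)) (ξ : (Fin d → ℕ) → H) :
    monoFun Φ ρ n f ξ (k + n) = ρ (Φ.pull k f) (ξ k) := by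
  simp [monoFun]

theorem norm_rep_apply_le (k : Fin d → ℕ) (f : C₀(X, ℂ)) (x : H) :
    ‖ρ (Φ.pull k f) x‖ ≤ ‖f‖ * ‖x‖ := by
  refine (ContinuousLinearMap.le_opNorm _ _).trans ?_
  gcongr
  exact (NonUnitalStarAlgHom.norm_apply_le ρ _).trans (Φ.norm_pull_le k f)

theorem hasSum_monoFun (n : Fin d → ℕ) (f : C₀(X, ℂ)) (ξ : Fock d H) :
    Summable (fun k => ‖monoFun Φ ρ n f ξ k‖ ^ (2 : ℝ)) ∧
      ∑' k, ‖monoFun Φ ρ n f ξ k‖ ^ (2 : ℝ) ≤ (‖f‖ * ‖ξ‖) ^ (2 : ℝ) := by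
  have hinj : Function.Injective (fun k : Fin d → ℕ => k + n) := add_left_injective n
  have hsupp : ∀ k ∉ Set.range (fun k : Fin d → ℕ => k + n),
      ‖monoFun Φ ρ n f ξ k‖ ^ (2 : ℝ) = 0 := by
    intro k hk
    have : ¬ n ≤ k := fun h => hk ⟨k - n, tsub_add_cancel_of_le h⟩
    simp [monoFun, this]
  have hle : ∀ k, ‖monoFun Φ ρ n f ξ (k + n)‖ ^ (2 : ℝ) ≤ ‖f‖ ^ (2 : ℝ) * ‖ξ k‖ ^ (2 : ℝ) := by
    intro k
    rw [monoFun_add_right, ← Real.mul_rpow (norm_nonneg _) (norm_nonneg _)]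
    exact Real.rpow_le_rpow (norm_nonneg _) (norm_rep_apply_le Φ ρ k f _) (by norm_num)
  have hξ : Summable (fun k => ‖ξ k‖ ^ (2 : ℝ)) := by
    simpa using (lp.memℓp ξ).summable (by norm_num)
  have hξ' : ‖ξ‖ ^ (2 : ℝ) = ∑' k, ‖ξ k‖ ^ (2 : ℝ) := by
    simpa using lp.norm_rpow_eq_tsum (p := 2) (by norm_num) ξ
  have hs : Summable (fun k => ‖monoFun Φ ρ n f ξ (k + n)‖ ^ (2 : ℝ)) :=
    Summable.of_nonneg_of_le (fun k => by positivity) hle (hξ.mul_left _)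
  refine ⟨(hinj.summable_iff hsupp).1 hs, ?_⟩
  rw [← hinj.tsum_eq (f := fun k => ‖monoFun Φ ρ n f ξ k‖ ^ (2 : ℝ))
    (fun k hk => by_contra fun h => hk (hsupp k h)),
    Real.mul_rpow (norm_nonneg _) (norm_nonneg _), hξ', ← tsum_mul_left]
  exact hs.tsum_le_tsum hle (hξ.mul_left _)

theorem memℓp_monoFun (n : Fin d → ℕ) (f : C₀(X, ℂ)) (ξ : Fock d H) :
    Memℓp (monoFun Φ ρ n f ξ) 2 :=
  memℓp_gen (by simpa using (hasSum_monoFun Φ ρ n f ξ).1)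

/-- The monomial `π(Uₙ f)`: the bounded operator on `H ⊗ ℓ²(ℤ₊ᵈ)` given by
`π(Uₙ f)(ξ ⊗ e_k) = ρ(α_k(f)) ξ ⊗ e_{k+n}`. -/
def mono (n : Fin d → ℕ) (f : C₀(X, ℂ)) : Fock d H →L[ℂ] Fock d H :=
  LinearMap.mkContinuous
    { toFun := fun ξ => ⟨monoFun Φ ρ n f ξ, memℓp_monoFun Φ ρ n f ξ⟩
      map_add' := fun ξ η => by
        ext k
        change monoFun Φ ρ n f (⇑ξ + ⇑η) k = monoFun Φ ρ n f ξ k + monoFun Φ ρ n f η k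
        by_cases h : n ≤ k <;> simp [monoFun, h]
      map_smul' := fun c ξ => by
        ext k
        by_cases h : n ≤ k <;> simp [monoFun, h] }
    ‖f‖ (fun ξ => by
      refine lp.norm_le_of_tsum_le (by norm_num) (by positivity) ?_
      simpa using (hasSum_monoFun Φ ρ n f ξ).2)

open scoped Classical in
theorem mono_apply (n : Fin d → ℕ) (f : C₀(X, ℂ)) (ξ : Fock d H) (k : Fin d → ℕ) :
    mono Φ ρ n f ξ k = if n ≤ k then ρ (Φ.pull (k - n) f) (ξ (k - n)) else 0 := rfl

theorem mono_single (n k : Fin d → ℕ) (f : C₀(X, ℂ)) (x : H) :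
    mono Φ ρ n f (lp.single 2 k x) = lp.single 2 (k + n) (ρ (Φ.pull k f) x) := by
  ext l
  rw [mono_apply]
  by_cases h : n ≤ l
  · by_cases hk : l = k + n
    · subst hk
      simp
    · have : l - n ≠ k := fun h' => hk (by rw [← h', tsub_add_cancel_of_le h])
      rw [if_pos h, lp.single_apply_ne _ _ _ this, lp.single_apply_ne _ _ _ hk, map_zero]
  · have hk : l ≠ k + n := fun h' => h (h' ▸ le_add_self)
    rw [if_neg h, lp.single_apply_ne _ _ _ hk]

theorem norm_mono_le (n : Fin d → ℕ) (f : C₀(X, ℂ)) : ‖mono Φ ρ n f‖ ≤ ‖f‖ :=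
  LinearMap.mkContinuous_norm_le _ (norm_nonneg f) _

theorem mono_add (n : Fin d → ℕ) (f g : C₀(X, ℂ)) :
    mono Φ ρ n (f + g) = mono Φ ρ n f + mono Φ ρ n g := by
  ext ξ k
  simp only [add_apply, lp.coeFn_add, Pi.add_apply, mono_apply]
  by_cases h : n ≤ k <;> simp [h, DynSys.pull_add]

theorem mono_smul (n : Fin d → ℕ) (c : ℂ) (f : C₀(X, ℂ)) :
    mono Φ ρ n (c • f) = c • mono Φ ρ n f := by
  ext ξ k
  simp only [smul_apply, lp.coeFn_smul, Pi.smul_apply, mono_apply]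
  by_cases h : n ≤ k <;> simp [h, DynSys.pull_smul]

/-- The multiplication rule `Uₙ f Uₘ g = U_{n+m} (αₘ(f) g)`. -/
theorem mono_mul (n m : Fin d → ℕ) (f g : C₀(X, ℂ)) :
    mono Φ ρ n f * mono Φ ρ m g = mono Φ ρ (n + m) (Φ.pull m f * g) := by
  ext ξ k
  rw [mul_apply_eq_comp, mono_apply, mono_apply, mono_apply]
  by_cases h : n + m ≤ k
  · have h1 : n ≤ k := le_self_add.trans h
    have h2 : m ≤ k - n := le_tsub_of_add_le_left h
    have h3 : m + (k - n - m) = k - n := add_tsub_cancel_of_le h2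
    rw [if_pos h, if_pos h1, if_pos h2, Φ.pull_mul, Φ.pull_pull, ← tsub_tsub, h3, map_mul]
    rfl
  · rw [if_neg h]
    by_cases h1 : n ≤ k
    · have h2 : ¬ m ≤ k - n := fun h2 => h ((add_le_add_right h2 n).trans_eq
        (add_tsub_cancel_of_le h1))
      rw [if_pos h1, if_neg h2, map_zero]
    · rw [if_neg h1]

/-- The representation `π` of `ℓ¹(ℤ₊ᵈ, C₀(X))`: `π(∑ Uₙ fₙ) = ∑ π(Uₙ fₙ)`. -/
def l1Rep (a : lp (fun _ : Fin d → ℕ => C₀(X, ℂ)) 1) : Fock d H →L[ℂ] Fock d H :=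
  ∑' n, mono Φ ρ n (a n)

theorem summable_l1Rep (a : lp (fun _ : Fin d → ℕ => C₀(X, ℂ)) 1) :
    Summable (fun n => mono Φ ρ n (a n)) := by
  have ha : Summable (fun n => ‖a n‖) := by
    simpa using (lp.memℓp a).summable (by norm_num)
  exact Summable.of_norm_bounded ha (fun n => norm_mono_le Φ ρ n (a n))

/-- The algebra of trigonometric polynomials: finite sums of monomials. -/
def trigPoly : NonUnitalSubalgebra ℂ (Fock d H →L[ℂ] Fock d H) :=
  { Submodule.span ℂ (Set.range fun p : (Fin d → ℕ) × C₀(X, ℂ) => mono Φ ρ p.1 p.2) with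
    mul_mem' := by
      intro a b ha hb
      change a ∈ Submodule.span ℂ _ at ha
      change b ∈ Submodule.span ℂ _ at hb
      change a * b ∈ Submodule.span ℂ _
      induction ha using Submodule.span_induction with
      | mem x hx =>
        obtain ⟨p, rfl⟩ := hx
        induction hb using Submodule.span_induction with
        | mem y hy =>
          obtain ⟨q, rfl⟩ := hy
          exact Submodule.subset_span ⟨(p.1 + q.1, Φ.pull q.1 p.2 * q.2),
            (mono_mul Φ ρ _ _ _ _).symm⟩
        | zero => rw [mul_zero]; exact Submodule.zero_mem _
        | add y z _ _ hy hz => rw [mul_add]; exact Submodule.add_mem _ hy hz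
        | smul c y _ hy => rw [mul_smul_comm]; exact Submodule.smul_mem _ c hy
      | zero => rw [zero_mul]; exact Submodule.zero_mem _
      | add y z _ _ hy hz => rw [add_mul]; exact Submodule.add_mem _ hy hz
      | smul c y _ hy => rw [smul_mul_assoc]; exact Submodule.smul_mem _ c hy }

theorem mono_mem_trigPoly (n : Fin d → ℕ) (f : C₀(X, ℂ)) : mono Φ ρ n f ∈ trigPoly Φ ρ :=
  Submodule.subset_span (s := Set.range fun p : (Fin d → ℕ) × C₀(X, ℂ) => mono Φ ρ p.1 p.2)
    ⟨(n, f), rfl⟩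

theorem mono_eq_l1Rep (n : Fin d → ℕ) (f : C₀(X, ℂ)) :
    l1Rep Φ ρ (lp.single 1 n f) = mono Φ ρ n f := by
  rw [l1Rep, tsum_eq_single n, lp.single_apply_self]
  intro k hk
  rw [lp.single_apply_ne _ _ _ hk]
  simpa using mono_smul Φ ρ k 0 0

theorem closure_range_l1Rep :
    closure (Set.range (l1Rep Φ ρ)) = closure (trigPoly Φ ρ : Set (Fock d H →L[ℂ] Fock d H)) := by
  apply Set.Subset.antisymm
  · refine closure_minimal ?_ isClosed_closure
    rintro _ ⟨a, rfl⟩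
    refine mem_closure_of_tendsto (summable_l1Rep Φ ρ a).hasSum (Eventually.of_forall fun s => ?_)
    exact sum_mem fun n _ => mono_mem_trigPoly Φ ρ n (a n)
  · refine closure_mono fun x hx => ?_
    change x ∈ Submodule.span ℂ _ at hx
    induction hx using Submodule.span_induction with
    | mem x hx =>
      obtain ⟨p, rfl⟩ := hx
      exact ⟨_, mono_eq_l1Rep Φ ρ p.1 p.2⟩
    | zero => exact ⟨lp.single 1 0 0, by
        rw [mono_eq_l1Rep]; simpa using mono_smul Φ ρ (0 : Fin d → ℕ) 0 0⟩
    | add y z _ _ hy hz =>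
      obtain ⟨a, rfl⟩ := hy
      obtain ⟨b, rfl⟩ := hz
      refine ⟨a + b, ?_⟩
      rw [l1Rep, l1Rep, l1Rep, ← (summable_l1Rep Φ ρ a).tsum_add (summable_l1Rep Φ ρ b)]
      exact tsum_congr fun n => mono_add Φ ρ n (a n) (b n)
    | smul c y _ hy =>
      obtain ⟨a, rfl⟩ := hy
      refine ⟨c • a, ?_⟩
      rw [l1Rep, l1Rep, ← (summable_l1Rep Φ ρ a).tsum_const_smul c]
      exact tsum_congr fun n => mono_smul Φ ρ n c (a n)

/-- The analytic crossed product `C₀(X) ×_φ ℤ₊ᵈ` defined by the representation `ρ` of `C₀(X)`: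
the operator norm closure of `π(ℓ¹(ℤ₊ᵈ, C₀(X)))`. -/
def crossedProduct : NonUnitalSubalgebra ℂ (Fock d H →L[ℂ] Fock d H) :=
  (trigPoly Φ ρ).topologicalClosure.copy (closure (Set.range (l1Rep Φ ρ)))
    (closure_range_l1Rep Φ ρ)

theorem mono_mem (n : Fin d → ℕ) (f : C₀(X, ℂ)) : mono Φ ρ n f ∈ crossedProduct Φ ρ :=
  subset_closure ⟨_, mono_eq_l1Rep Φ ρ n f⟩

/-- The monomial `Uₙ f` as an element of the crossed product. -/
def monomial (n : Fin d → ℕ) (f : C₀(X, ℂ)) : crossedProduct Φ ρ :=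
  ⟨mono Φ ρ n f, mono_mem Φ ρ n f⟩

/-- `R_{J,γ}`: the closed ideal generated by the monomials `Uₙ f` with `n ∈ Σ_J` and
`f ∈ C₀(X)` vanishing on `X_{J,γ}`. -/
def idealR (J : Set (Fin d)) (γ : Ordinal.{w}) : Submodule ℂ (crossedProduct Φ ρ) :=
  closedIdealSpan {a | ∃ n ∈ sigma J, ∃ f : C₀(X, ℂ),
    (∀ x ∈ Φ.stage J γ, f x = 0) ∧ a = monomial Φ ρ n f}

/-- `S_{J,γ}`: the set of all `B f = B (U₀ f)` with `B ∈ R_{J,γ}` and `f` of compact support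
disjoint from `X_{J,γ}`. -/
def setS (J : Set (Fin d)) (γ : Ordinal.{w}) : Set (crossedProduct Φ ρ) :=
  {a | ∃ B ∈ idealR Φ ρ J γ, ∃ f : C₀(X, ℂ),
    HasCompactSupport f ∧ Disjoint (tsupport f) (Φ.stage J γ) ∧ a = B * monomial Φ ρ 0 f}

end CrossedProduct

end AnalyticCrossedProduct

end

open AnalyticCrossedProduct

/-!
The radicals enter only through one property: each is a *semiprime* two-sided ideal `Q`, meaning
that `a A a ⊆ Q` forces `a ∈ Q`. An intersection of prime ideals has this property, and primitive
ideals are prime. In a Banach algebra primitive ideals are moreover closed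
(`isClosed_of_isPrimitiveIdeal`), hence so is the Jacobson radical, whereas closedness of the prime
radical has to be assumed. It thus suffices to prove `R_{J,γ} ⊆ Q` for every closed semiprime ideal
`Q`; since `R_{J,γ}` is an ideal, this also covers `S_{J,γ} ⊆ R_{J,γ}`.

The proof is a transfinite induction on `γ` (`monomial_mem_of_semiprime`): if `n ∈ Σ_J` and `f`
vanishes on `X_{J,γ}`, then `Uₙ f ∈ Q`. A partition of unity (`mem_of_locally_mem`) makes this a
local question: each point off `X_{J,γ}` needs a neighbourhood `O` such that `Uₙ f ∈ Q` for all
`f` vanishing off `O`. For a point off an earlier `X_{J,δ}`, the complement of `X_{J,δ}` works;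
this settles limit ordinals. The remaining points of `X_{J,δ}` off `X_{J,δ+1}` lie in a wandering
set `O ∩ X_{J,δ}`. If `f` vanishes off `O`, then
`Uₙ f · Uₘ g · Uₙ f = U_{n+m+n} (α_{m+n}(f) αₙ(g) f)`, and `α_{m+n}(f) f` vanishes on `X_{J,δ}`
because `m + n ∈ Σ_J`. So `Uₙ f A Uₙ f ⊆ Q` by induction, and semiprimeness gives `Uₙ f ∈ Q`.
-/

noncomputable section

namespace AnalyticCrossedProduct

/-! ### Semiprime, prime and primitive ideals -/

section Ideals

variable {A : Type u} [NonUnitalRing A] [Module ℂ A]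

/-- A linear subspace `Q` is semiprime if `a A a ⊆ Q` implies `a ∈ Q`. -/
def IsSemiprime (Q : Submodule ℂ A) : Prop :=
  ∀ a : A, (∀ b : A, a * b * a ∈ Q) → a ∈ Q

theorem IsTwoSidedIdeal.sInf {S : Set (Submodule ℂ A)} (hS : ∀ P ∈ S, IsTwoSidedIdeal P) :
    IsTwoSidedIdeal (sInf S) := by
  intro a x hx
  rw [Submodule.mem_sInf] at hx
  simp only [Submodule.mem_sInf]
  exact ⟨fun P hP => (hS P hP a x (hx P hP)).1, fun P hP => (hS P hP a x (hx P hP)).2⟩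

theorem IsSemiprime.sInf {S : Set (Submodule ℂ A)} (hS : ∀ P ∈ S, IsSemiprime P) :
    IsSemiprime (sInf S) := by
  intro a ha
  simp only [Submodule.mem_sInf] at ha ⊢
  exact fun P hP => hS P hP a fun b => ha b P hP

theorem IsPrimeIdeal.isSemiprime [IsScalarTower ℂ A A] [SMulCommClass ℂ A A]
    {P : Submodule ℂ A} (hP : IsPrimeIdeal P) : IsSemiprime P := by
  obtain ⟨hI, hne, hprime⟩ := hP
  intro a ha
  -- `I = {x | x A a ⊆ P}` contains `a`, and `K = {y | I y ⊆ P}` contains `A a`.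
  let I : Submodule ℂ A :=
    { carrier := {x | ∀ b, x * b * a ∈ P}
      zero_mem' := fun b => by simp
      add_mem' := fun {x y} hx hy b => by
        rw [add_mul, add_mul]; exact P.add_mem (hx b) (hy b)
      smul_mem' := fun c x hx b => by
        rw [smul_mul_assoc, smul_mul_assoc]; exact P.smul_mem c (hx b) }
  have hII : IsTwoSidedIdeal I := fun c x hx =>
    ⟨fun b => by rw [mul_assoc c, mul_assoc c]; exact (hI c _ (hx b)).1,
      fun b => by rw [mul_assoc x]; exact hx (c * b)⟩
  let K : Submodule ℂ A :=
    { carrier := {y | ∀ x ∈ I, x * y ∈ P}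
      zero_mem' := fun x _ => by simp
      add_mem' := fun {y z} hy hz x hx => by
        rw [mul_add]; exact P.add_mem (hy x hx) (hz x hx)
      smul_mem' := fun c y hy x hx => by
        rw [mul_smul_comm]; exact P.smul_mem c (hy x hx) }
  have hK : IsTwoSidedIdeal K := fun c y hy =>
    ⟨fun x hx => by rw [← mul_assoc]; exact hy _ (hII c x hx).2,
      fun x hx => by rw [← mul_assoc]; exact (hI c _ (hy x hx)).2⟩
  rcases hprime I K hII hK (fun x hx y hy => hy x hx) with h | h
  · exact h ha
  -- Now `A a ⊆ P`; as `A` need not be unital, primeness is used once more, with `⊤` as a factor.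
  let L : Submodule ℂ A :=
    { carrier := {y | ∀ b, b * y ∈ P}
      zero_mem' := fun b => by simp
      add_mem' := fun {y z} hy hz b => by rw [mul_add]; exact P.add_mem (hy b) (hz b)
      smul_mem' := fun c y hy b => by rw [mul_smul_comm]; exact P.smul_mem c (hy b) }
  have hL : IsTwoSidedIdeal L := fun c y hy =>
    ⟨fun b => by rw [← mul_assoc]; exact hy _,
      fun b => by rw [← mul_assoc]; exact (hI c _ (hy b)).2⟩
  rcases hprime ⊤ L (fun _ _ _ => ⟨trivial, trivial⟩) hL (fun x _ y hy => hy x) with h' | h'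
  · exact absurd (top_le_iff.1 h') hne
  · exact h' fun b => h fun x hx => by rw [← mul_assoc]; exact hx b

variable {V : Type u} [AddCommGroup V] [Module ℂ V] {τ : A →ₙₐ[ℂ] Module.End ℂ V}

/-- In an irreducible representation, a left ideal which does not annihilate the vector `v` maps
`v` onto the whole space. -/
theorem IsIrreducibleRep.exists_apply_eq (hτ : IsIrreducibleRep τ) (K : Submodule ℂ A)
    (hK : ∀ a : A, ∀ x ∈ K, a * x ∈ K) {v : V} (hv : ∃ k ∈ K, τ k v ≠ 0) (w : V) :
    ∃ k ∈ K, τ k v = w := by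
  let W : Submodule ℂ V :=
    { carrier := {w | ∃ k ∈ K, τ k v = w}
      zero_mem' := ⟨0, K.zero_mem, by simp⟩
      add_mem' := by
        rintro _ _ ⟨k, hk, rfl⟩ ⟨l, hl, rfl⟩
        exact ⟨k + l, K.add_mem hk hl, by simp⟩
      smul_mem' := by
        rintro c _ ⟨k, hk, rfl⟩
        exact ⟨c • k, K.smul_mem c hk, by simp⟩ }
  have hW : ∀ a : A, ∀ x ∈ W, τ a x ∈ W := by
    rintro a _ ⟨k, hk, rfl⟩
    exact ⟨a * k, hK a k hk, by rw [map_mul, Module.End.mul_apply]⟩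
  rcases hτ.2 W hW with h | h
  · obtain ⟨k, hk, hkv⟩ := hv
    have : τ k v ∈ W := ⟨k, hk, rfl⟩
    rw [h, Submodule.mem_bot] at this
    exact absurd this hkv
  · have : w ∈ W := h ▸ Submodule.mem_top
    exact this

theorem IsPrimitiveIdeal.isPrimeIdeal {P : Submodule ℂ A} (hP : IsPrimitiveIdeal P) :
    IsPrimeIdeal P := by
  obtain ⟨V, _, _, τ, hτ, hPτ⟩ := hP
  refine ⟨fun a x hx => ?_, ?_, fun I K _ hK hIK => ?_⟩
  · rw [hPτ] at hx
    simp [hPτ, hx]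
  · rintro rfl
    obtain ⟨a, ha⟩ := hτ.1
    exact ha ((hPτ a).1 trivial)
  · by_contra! hcon
    obtain ⟨k, hk, hkP⟩ := SetLike.not_le_iff_exists.1 hcon.2
    have hk0 : τ k ≠ 0 := fun h => hkP ((hPτ k).2 h)
    obtain ⟨v, hv⟩ := DFunLike.ne_iff.1 hk0
    refine hcon.1 fun x hx => (hPτ x).2 (LinearMap.ext fun w => ?_)
    obtain ⟨l, hl, rfl⟩ := hτ.exists_apply_eq K (fun a y hy => (hK a y hy).1) ⟨k, hk, hv⟩ w
    have := (hPτ _).1 (hIK x hx l hl)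
    rw [map_mul] at this
    exact LinearMap.congr_fun this v

end Ideals

/-! ### Closedness of the Jacobson radical of a Banach algebra -/

section Banach

/-- In a Banach algebra, every `x` with `‖x‖ < 1` is quasi-invertible: in the unitization,
`1 + y = (1 - x)⁻¹`, where `y` is the Neumann series `x + x² + ⋯`. -/
theorem exists_quasiInverse {A : Type u} [NonUnitalNormedRing A] [CompleteSpace A]
    {x : A} (hx : ‖x‖ < 1) : ∃ y : A, y * x = y - x := by
  let s : ℕ → A := fun k => (fun z => z * x)^[k] x
  have hs : ∀ k, s (k + 1) = s k * x := fun k => Function.iterate_succ_apply' _ _ _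
  have hn : ∀ k, ‖s k‖ ≤ ‖x‖ * ‖x‖ ^ k := by
    intro k
    induction k with
    | zero => simp [s]
    | succ k ih =>
      rw [hs, pow_succ, ← mul_assoc]
      exact (norm_mul_le _ _).trans (by gcongr)
  have hsum : Summable s := Summable.of_norm_bounded
    ((summable_geometric_of_lt_one (norm_nonneg x) hx).mul_left _) hn
  refine ⟨∑' k, s k, ?_⟩
  rw [← hsum.tsum_mul_right, hsum.tsum_eq_zero_add]
  simp [hs, s]

variable {A : Type u} [NonUnitalNormedRing A] [Module ℂ A]
  [ContinuousConstSMul ℂ A]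

/-- A primitive ideal of a Banach algebra is the intersection of the annihilators
`{a | τ a v = 0}` of the vectors `v`. If the closure of such a left ideal were larger, it would
contain some `b` with `τ b v = v`; subtracting a nearby element of the annihilator makes `‖b‖ < 1`,
and then `1 - b` is invertible, contradicting `τ (1 - b) v = 0`. -/
theorem isClosed_of_isPrimitiveIdeal [CompleteSpace A] {P : Submodule ℂ A}
    (hP : IsPrimitiveIdeal P) : IsClosed (P : Set A) := by
  obtain ⟨V, _, _, τ, hτ, hPτ⟩ := hP
  rw [← closure_subset_iff_isClosed]
  intro a ha
  refine (hPτ a).2 (LinearMap.ext fun v => ?_)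
  by_contra hav
  let L : Submodule ℂ A :=
    { carrier := {b | τ b v = 0}
      zero_mem' := by simp
      add_mem' := fun {b c} (hb : τ b v = 0) (hc : τ c v = 0) => by simp [hb, hc]
      smul_mem' := fun c b (hb : τ b v = 0) => by simp [hb] }
  have haL : a ∈ L.topologicalClosure :=
    closure_mono (fun b hb => by
      change τ b v = 0
      rw [(hPτ b).1 hb]; rfl) ha
  have hL : ∀ c : A, ∀ x ∈ L.topologicalClosure, c * x ∈ L.topologicalClosure := by
    intro c x hx
    refine map_mem_closure (continuous_const_mul c) hx fun y hy => ?_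
    change τ (c * y) v = 0
    rw [map_mul, Module.End.mul_apply, show τ y v = 0 from hy, map_zero]
  obtain ⟨b, hb, hbv⟩ := hτ.exists_apply_eq L.topologicalClosure hL ⟨a, haL, hav⟩ v
  obtain ⟨c, hc, hbc⟩ := Metric.mem_closure_iff.1 hb 1 one_pos
  rw [dist_eq_norm] at hbc
  obtain ⟨y, hy⟩ := exists_quasiInverse hbc
  have hv : τ (b - c) v = v := by
    rw [map_sub, LinearMap.sub_apply, hbv, show τ c v = 0 from hc, sub_zero]
  have h := congrArg (fun z => τ z v) hy
  simp only [map_mul, Module.End.mul_apply, hv] at h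
  rw [map_sub, LinearMap.sub_apply, hv] at h
  have hv0 : v = 0 := sub_eq_self.1 h.symm
  exact hav (by simp [hv0])

variable (A) in
theorem isClosed_jacobsonRadical [CompleteSpace A] :
    IsClosed (jacobsonRadical A : Set A) := by
  rw [jacobsonRadical, Submodule.coe_sInf]
  exact isClosed_biInter fun P hP => isClosed_of_isPrimitiveIdeal hP

end Banach

/-! ### Closed subspaces of `C₀(X)` determined by local conditions -/

section Local

variable {X : Type u} [TopologicalSpace X]

/-- The product of `f ∈ C₀(X)` and a bounded real function, here with values in `[0, 1]`. -/
def cutoff (χ : C(X, ℝ)) (hχ : ∀ x, χ x ∈ Icc (0 : ℝ) 1) (f : C₀(X, ℂ)) : C₀(X, ℂ) where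
  toFun x := χ x * f x
  continuous_toFun := by
    have := f.continuous
    fun_prop
  zero_at_infty' := by
    refine squeeze_zero_norm (fun x => ?_) (tendsto_zero_iff_norm_tendsto_zero.1 f.zero_at_infty')
    rw [norm_mul, Complex.norm_real, Real.norm_of_nonneg (hχ x).1]
    exact mul_le_of_le_one_left (norm_nonneg _) (hχ x).2

@[simp] theorem cutoff_apply (χ : C(X, ℝ)) (hχ : ∀ x, χ x ∈ Icc (0 : ℝ) 1) (f : C₀(X, ℂ)) (x : X) :
    cutoff χ hχ f x = χ x * f x := rfl

theorem isCompact_le_norm (f : C₀(X, ℂ)) {ε : ℝ} (hε : 0 < ε) : IsCompact {x | ε ≤ ‖f x‖} := by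
  have h : {x | ‖f x‖ < ε} ∈ cocompact X := by
    have := f.zero_at_infty'.eventually (Metric.ball_mem_nhds 0 hε)
    simpa [Filter.Eventually] using this
  obtain ⟨t, ht, hts⟩ := mem_cocompact.1 h
  refine ht.of_isClosed_subset (isClosed_le continuous_const f.continuous.norm) fun x hx => ?_
  by_contra hxt
  exact absurd (show ‖f x‖ < ε from hts hxt) (not_lt.2 hx)

/-- Shrinking the values of `f` towards zero by at most `ε` gives a function which vanishes
wherever `‖f x‖ ≤ ε`. -/
theorem exists_cutoff_norm_sub_le (f : C₀(X, ℂ)) {ε : ℝ} (hε : 0 < ε) :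
    ∃ (θ : C(X, ℝ)) (hθ : ∀ x, θ x ∈ Icc (0 : ℝ) 1),
      (∀ x, ‖f x‖ ≤ ε → θ x = 0) ∧ ‖cutoff θ hθ f - f‖ ≤ ε := by
  have hm : ∀ x, 0 < max ε ‖f x‖ := fun x => lt_max_of_lt_left hε
  have hf := f.continuous
  let θ : C(X, ℝ) := ⟨fun x => 1 - ε / max ε ‖f x‖, by
    refine continuous_const.sub (continuous_const.div (by fun_prop) fun x => (hm x).ne')⟩
  have hθ : ∀ x, θ x ∈ Icc (0 : ℝ) 1 := fun x =>
    ⟨sub_nonneg.2 ((div_le_one (hm x)).2 (le_max_left _ _)),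
      sub_le_self _ (div_nonneg hε.le (hm x).le)⟩
  refine ⟨θ, hθ, fun x hx => ?_, ?_⟩
  · change 1 - ε / max ε ‖f x‖ = 0
    rw [max_eq_left hx, div_self hε.ne', sub_self]
  · rw [← ZeroAtInftyContinuousMap.norm_toBCF_eq_norm, BoundedContinuousFunction.norm_le hε.le]
    intro x
    have hx : (cutoff θ hθ f - f).toBCF x = -((ε / max ε ‖f x‖ : ℝ) * f x) := by
      change ((1 - ε / max ε ‖f x‖ : ℝ) : ℂ) * f x - f x = _
      push_cast
      ring
    rw [hx, norm_neg, norm_mul, Complex.norm_real, Real.norm_of_nonneg (by positivity),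
      div_mul_eq_mul_div, div_le_iff₀ (hm x)]
    gcongr
    exact le_max_right _ _

/-- A closed subspace of `C₀(X)` contains every function vanishing on `Y` as soon as each point off
`Y` has a neighbourhood `O` such that all functions vanishing off `O` belong to it. -/
theorem mem_of_locally_mem [LocallyCompactSpace X] [T2Space X] (N : Submodule ℂ C₀(X, ℂ))
    (hN : IsClosed (N : Set C₀(X, ℂ))) {Y : Set X}
    (hY : ∀ x ∉ Y, ∃ O, IsOpen O ∧ x ∈ O ∧ ∀ f : C₀(X, ℂ), (∀ y ∉ O, f y = 0) → f ∈ N)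
    (f : C₀(X, ℂ)) (hf : ∀ x ∈ Y, f x = 0) : f ∈ N := by
  change f ∈ (N : Set C₀(X, ℂ))
  rw [← hN.closure_eq, Metric.mem_closure_iff]
  intro ε hε
  obtain ⟨θ, hθ, hθ0, hθf⟩ := exists_cutoff_norm_sub_le f (half_pos hε)
  refine ⟨cutoff θ hθ f, ?_, ?_⟩
  swap
  · rw [dist_comm, dist_eq_norm]
    exact hθf.trans_lt (half_lt_self hε)
  set K : Set X := {x | ε / 2 ≤ ‖f x‖}
  have hK : IsCompact K := isCompact_le_norm f (half_pos hε)
  have hKY : ∀ x ∈ K, x ∉ Y := fun x hx hxY => by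
    have hx' : ε / 2 ≤ ‖f x‖ := hx
    rw [hf x hxY, norm_zero] at hx'
    linarith
  choose! O hO hxO hON using hY
  obtain ⟨t, htK, hKt⟩ := hK.elim_nhds_subcover O fun x hx => (hO x (hKY x hx)).mem_nhds
    (hxO x (hKY x hx))
  let e := t.equivFin
  obtain ⟨χ, hχO, hχ1, hχ, -⟩ := exists_continuous_sum_one_of_isOpen_isCompact
    (s := fun i => O (e.symm i)) (fun i => hO _ (hKY _ (htK _ (e.symm i).2))) hK (fun x hx => by
      obtain ⟨y, hy, hxy⟩ := mem_iUnion₂.1 (hKt hx)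
      exact mem_iUnion.2 ⟨e ⟨y, hy⟩, by simpa using hxy⟩)
  have hsum : cutoff θ hθ f = ∑ i, cutoff (χ i) (hχ i) (cutoff θ hθ f) := by
    ext x
    have hcoe : (∑ i, cutoff (χ i) (hχ i) (cutoff θ hθ f)) x
        = ∑ i, cutoff (χ i) (hχ i) (cutoff θ hθ f) x :=
      map_sum (⟨⟨fun g : C₀(X, ℂ) => g x, rfl⟩, fun _ _ => rfl⟩ : C₀(X, ℂ) →+ ℂ) _ _
    rw [hcoe]
    simp only [cutoff_apply]
    rw [← Finset.sum_mul]
    by_cases hx : x ∈ K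
    · have h1 : ∑ i, χ i x = 1 := by simpa using hχ1 hx
      rw [← Complex.ofReal_sum, h1, Complex.ofReal_one, one_mul]
    · rw [hθ0 x (not_le.1 hx).le]
      simp
  rw [hsum]
  refine sum_mem fun i _ => hON _ (hKY _ (htK _ (e.symm i).2)) _ fun y hy => ?_
  rw [cutoff_apply, image_eq_zero_of_notMem_tsupport fun h => hy (hχO i h)]
  simp

end Local

/-! ### The sets `X_{J,γ}` are closed and invariant -/

section Stages

variable {d : ℕ} {X : Type u} [TopologicalSpace X] (Φ : DynSys d X) (J : Set (Fin d))

theorem DynSys.map_comm (m n : Fin d → ℕ) (x : X) : Φ.map m (Φ.map n x) = Φ.map n (Φ.map m x) := by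
  rw [← Function.comp_apply (f := Φ.map m), ← Φ.map_add, add_comm, Φ.map_add, Function.comp_apply]

theorem DynSys.isClosed_peel {Y : Set X} (hY : IsClosed Y) : IsClosed (Φ.peel J Y) := by
  have h : Φ.peel J Y = Y \ ⋃₀ {O | IsOpen O ∧ Φ.IsWandering J Y (O ∩ Y)} := by
    ext x
    refine and_congr_right fun hx => not_congr ⟨?_, ?_⟩
    · rintro ⟨_, ⟨⟨O, hO, rfl⟩, hw⟩, hxO⟩
      exact ⟨O, ⟨hO, ⟨O, hO, rfl⟩, hw⟩, hxO.1⟩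
    · rintro ⟨O, ⟨_, hw⟩, hxO⟩
      exact ⟨O ∩ Y, hw, hxO, hx⟩
  rw [h]
  exact hY.sdiff (isOpen_sUnion fun O hO => hO.1)

/-- As the maps `φₙ` commute, the preimage of a wandering set is wandering; so `peel` preserves
invariance. -/
theorem DynSys.mapsTo_peel {Y : Set X} (hY : ∀ n, MapsTo (Φ.map n) Y Y) (n : Fin d → ℕ) :
    MapsTo (Φ.map n) (Φ.peel J Y) (Φ.peel J Y) := by
  rintro x ⟨hx, hxV⟩
  refine ⟨hY n hx, ?_⟩
  rintro ⟨_, ⟨⟨O, hO, rfl⟩, hw⟩, hxO⟩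
  refine hxV ⟨Φ.map n ⁻¹' O ∩ Y, ⟨⟨_, hO.preimage (Φ.proper n).continuous, rfl⟩, ?_⟩, hxO.1, hx⟩
  intro m hm
  refine eq_empty_of_forall_notMem ?_
  rintro y ⟨⟨hy1, hy2⟩, hy3, hy4⟩
  have hmem : Φ.map n y ∈ Φ.map m ⁻¹' (O ∩ Y) ∩ (O ∩ Y) := by
    refine ⟨?_, hy3, hY n hy4⟩
    rw [mem_preimage, Φ.map_comm]
    exact ⟨hy1, hY n hy2⟩
  rwa [hw m hm] at hmem

theorem DynSys.isClosed_stage (γ : Ordinal.{w}) : IsClosed (Φ.stage J γ) := by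
  induction γ using Ordinal.limitRecOn with
  | zero => rw [Φ.stage_zero]; exact isClosed_univ
  | add_one γ ih => rw [Φ.stage_add_one]; exact Φ.isClosed_peel J ih
  | limit β hβ ih => rw [Φ.stage_limit J β hβ]; exact isClosed_biInter ih

theorem DynSys.mapsTo_stage (γ : Ordinal.{w}) (n : Fin d → ℕ) :
    MapsTo (Φ.map n) (Φ.stage J γ) (Φ.stage J γ) := by
  induction γ using Ordinal.limitRecOn generalizing n with
  | zero => rw [Φ.stage_zero]; exact mapsTo_univ _ _
  | add_one γ ih => rw [Φ.stage_add_one]; exact Φ.mapsTo_peel J ih n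
  | limit β hβ ih =>
    rw [Φ.stage_limit J β hβ]
    intro x hx
    rw [mem_iInter₂] at hx ⊢
    exact fun δ hδ => ih δ hδ n (hx δ hδ)

end Stages

/-! ### Monomials in closed semiprime ideals -/

section CrossedProduct

variable {d : ℕ} {X : Type u} [TopologicalSpace X] (Φ : DynSys d X)
  {H : Type v} [NormedAddCommGroup H] [InnerProductSpace ℂ H] [CompleteSpace H]
  (ρ : C₀(X, ℂ) →⋆ₙₐ[ℂ] (H →L[ℂ] H))

theorem isClosed_crossedProduct :
    IsClosed (crossedProduct Φ ρ : Set (Fock d H →L[ℂ] Fock d H)) :=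
  isClosed_closure

instance : CompleteSpace (crossedProduct Φ ρ) :=
  (isClosed_crossedProduct Φ ρ).completeSpace_coe

theorem monomial_mul (n m : Fin d → ℕ) (f g : C₀(X, ℂ)) :
    monomial Φ ρ n f * monomial Φ ρ m g = monomial Φ ρ (n + m) (Φ.pull m f * g) :=
  Subtype.ext (mono_mul Φ ρ n m f g)

/-- The continuous linear map `f ↦ Uₙ f`. -/
def monomialCLM (n : Fin d → ℕ) : C₀(X, ℂ) →L[ℂ] crossedProduct Φ ρ :=
  LinearMap.mkContinuous
    { toFun := monomial Φ ρ n
      map_add' := fun f g => Subtype.ext (mono_add Φ ρ n f g)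
      map_smul' := fun c f => Subtype.ext (mono_smul Φ ρ n c f) }
    1 fun f => (norm_mono_le Φ ρ n f).trans_eq (one_mul _).symm

/-- A closed subspace contains `a A a` as soon as it contains `a (Uₘ g) a` for all monomials. -/
theorem mul_mul_mem_of_monomial {Q : Submodule ℂ (crossedProduct Φ ρ)}
    (hQ : IsClosed (Q : Set (crossedProduct Φ ρ))) {a : crossedProduct Φ ρ}
    (ha : ∀ m g, a * monomial Φ ρ m g * a ∈ Q) (b : crossedProduct Φ ρ) : a * b * a ∈ Q := by
  have himage : IsClosed ((↑) '' (Q : Set (crossedProduct Φ ρ)) : Set (Fock d H →L[ℂ] Fock d H)) :=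
    (isClosed_crossedProduct Φ ρ).isClosedEmbedding_subtypeVal.isClosedMap _ hQ
  have htrig : ∀ T ∈ trigPoly Φ ρ, (a * T * a : Fock d H →L[ℂ] Fock d H) ∈
      ((↑) '' (Q : Set (crossedProduct Φ ρ)) : Set (Fock d H →L[ℂ] Fock d H)) := by
    intro T hT
    change T ∈ Submodule.span ℂ _ at hT
    induction hT using Submodule.span_induction with
    | mem x hx =>
      obtain ⟨p, rfl⟩ := hx
      exact ⟨_, ha p.1 p.2, rfl⟩
    | zero => exact ⟨0, Q.zero_mem, by simp⟩
    | add y z _ _ hy hz =>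
      obtain ⟨y', hy', hy⟩ := hy
      obtain ⟨z', hz', hz⟩ := hz
      refine ⟨y' + z', Q.add_mem hy' hz', ?_⟩
      rw [mul_add, add_mul, ← hy, ← hz]
      rfl
    | smul c y _ hy =>
      obtain ⟨y', hy', hy⟩ := hy
      refine ⟨c • y', Q.smul_mem c hy', ?_⟩
      rw [mul_smul_comm, smul_mul_assoc, ← hy]
      rfl
  have hb : (b : Fock d H →L[ℂ] Fock d H) ∈ closure (trigPoly Φ ρ : Set _) := by
    rw [← closure_range_l1Rep]
    exact b.2
  have hmem := map_mem_closure
    (f := fun T : Fock d H →L[ℂ] Fock d H => (a * T * a : Fock d H →L[ℂ] Fock d H))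
    (by fun_prop) hb htrig
  rw [himage.closure_eq] at hmem
  obtain ⟨q, hq, hqb⟩ := hmem
  have : q = a * b * a := Subtype.ext hqb
  exact this ▸ hq

theorem setS_subset_idealR (J : Set (Fin d)) (γ : Ordinal.{w}) :
    setS Φ ρ J γ ⊆ idealR Φ ρ J γ := by
  rintro _ ⟨B, hB, f, -, -, rfl⟩
  exact (IsTwoSidedIdeal.sInf (fun _ hI => hI.1) (monomial Φ ρ 0 f) B hB).2

variable [LocallyCompactSpace X] [T2Space X]

theorem monomial_mem_of_semiprime {Q : Submodule ℂ (crossedProduct Φ ρ)}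
    (hQc : IsClosed (Q : Set (crossedProduct Φ ρ))) (hQs : IsSemiprime Q) (J : Set (Fin d))
    (γ : Ordinal.{w}) (n : Fin d → ℕ) (hn : n ∈ sigma J) (f : C₀(X, ℂ))
    (hf : ∀ x ∈ Φ.stage J γ, f x = 0) : monomial Φ ρ n f ∈ Q := by
  induction γ using Ordinal.limitRecOn generalizing n f with
  | zero =>
    have hf0 : f = 0 := by
      ext x
      exact hf x (by rw [Φ.stage_zero]; trivial)
    rw [hf0, show monomial Φ ρ n 0 = 0 from (monomialCLM Φ ρ n).map_zero]
    exact Q.zero_mem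
  | limit β hβ ih =>
    rw [Φ.stage_limit J β hβ] at hf
    refine mem_of_locally_mem (Q.comap (monomialCLM Φ ρ n).toLinearMap)
      (hQc.preimage (monomialCLM Φ ρ n).continuous) (fun x hx => ?_) f hf
    obtain ⟨δ, hδ, hxδ⟩ : ∃ δ < β, x ∉ Φ.stage J δ := by simpa using hx
    exact ⟨(Φ.stage J δ)ᶜ, (Φ.isClosed_stage J δ).isOpen_compl, hxδ,
      fun g hg => ih δ hδ n hn g fun y hy => hg y (not_not.2 hy)⟩
  | add_one γ ih =>
    rw [Φ.stage_add_one] at hf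
    refine mem_of_locally_mem (Q.comap (monomialCLM Φ ρ n).toLinearMap)
      (hQc.preimage (monomialCLM Φ ρ n).continuous) (fun x hx => ?_) f hf
    by_cases hxγ : x ∈ Φ.stage J γ
    swap
    · exact ⟨(Φ.stage J γ)ᶜ, (Φ.isClosed_stage J γ).isOpen_compl, hxγ,
        fun g hg => ih n hn g fun y hy => hg y (not_not.2 hy)⟩
    obtain ⟨_, ⟨⟨O, hO, rfl⟩, hw⟩, hxO⟩ : x ∈ ⋃₀ {V | Φ.IsWandering J (Φ.stage J γ) V} := by
      by_contra h
      exact hx ⟨hxγ, h⟩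
    refine ⟨O, hO, hxO.1, fun g hg => hQs _ (mul_mul_mem_of_monomial Φ ρ hQc fun m h => ?_)⟩
    change monomial Φ ρ n g * monomial Φ ρ m h * monomial Φ ρ n g ∈ Q
    rw [mul_assoc, monomial_mul, monomial_mul]
    have hmn : m + n ∈ sigma J := fun j hj => Nat.add_pos_right _ (hn j hj)
    refine ih _ (fun j hj => Nat.add_pos_left (hn j hj) _) _ fun y hy => ?_
    change g (Φ.map (m + n) y) * (h (Φ.map n y) * g y) = 0
    -- Otherwise `y` and `φ_{m+n}(y)` both lie in the wandering set `O ∩ X_{J,γ}`.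
    by_cases hyO : y ∈ O
    · have hout : Φ.map (m + n) y ∉ O := fun h' =>
        (hw _ hmn).subset ⟨⟨h', Φ.mapsTo_stage J γ _ hy⟩, hyO, hy⟩
      rw [hg _ hout, zero_mul]
    · rw [hg _ hyO, mul_zero, mul_zero]

theorem idealR_le_of_semiprime {Q : Submodule ℂ (crossedProduct Φ ρ)} (hQi : IsTwoSidedIdeal Q)
    (hQc : IsClosed (Q : Set (crossedProduct Φ ρ))) (hQs : IsSemiprime Q) (J : Set (Fin d))
    (γ : Ordinal.{w}) : idealR Φ ρ J γ ≤ Q := by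
  refine sInf_le ⟨hQi, hQc, ?_⟩
  rintro _ ⟨n, hn, f, hf, rfl⟩
  exact monomial_mem_of_semiprime Φ ρ hQc hQs J γ n hn f hf

end CrossedProduct

end AnalyticCrossedProduct

end

theorem proposition3p4 {d : ℕ} {X : Type u} [TopologicalSpace X] [LocallyCompactSpace X]
    [TopologicalSpace.MetrizableSpace X] (Φ : DynSys d X)
    {H : Type v} [NormedAddCommGroup H] [InnerProductSpace ℂ H] [CompleteSpace H]
    (ρ : C₀(X, ℂ) →⋆ₙₐ[ℂ] (H →L[ℂ] H)) (hρ : Function.Injective ρ)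
    (J : Set (Fin d)) (γ : Ordinal.{w}) :
    setS Φ ρ J γ ⊆ (jacobsonRadical (crossedProduct Φ ρ) : Set (crossedProduct Φ ρ)) ∧
    idealR Φ ρ J γ ≤ jacobsonRadical (crossedProduct Φ ρ) ∧
    (IsClosed (primeRadical (crossedProduct Φ ρ) : Set (crossedProduct Φ ρ)) →
      idealR Φ ρ J γ ≤ primeRadical (crossedProduct Φ ρ)) := by
  have hJ : idealR Φ ρ J γ ≤ jacobsonRadical (crossedProduct Φ ρ) :=
    idealR_le_of_semiprime Φ ρ (Q := jacobsonRadical (crossedProduct Φ ρ))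
      (IsTwoSidedIdeal.sInf fun _ hP => hP.isPrimeIdeal.1)
      (isClosed_jacobsonRadical (crossedProduct Φ ρ)) (IsSemiprime.sInf fun _ hP => hP.isPrimeIdeal.isSemiprime) J γ
  exact ⟨(setS_subset_idealR Φ ρ J γ).trans hJ, hJ, fun hclosed =>
    idealR_le_of_semiprime Φ ρ (IsTwoSidedIdeal.sInf fun _ hP => hP.1) hclosed
      (IsSemiprime.sInf fun _ hP => hP.isSemiprime) J γ⟩
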